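/- Let $G\subseteq K_{m,n}$ be a connected bipartite graph with vertex set $V=U_1\sqcup U_2$, $|U_1|=m$, $|U_2|=n$, and $G\neq K_{1,1}$. Put $(1,-1):=\sum_{i} e_i-\sum_{j} f_j\in\mathbb Z^{m+n}$, $M_{\mathbb Q}:=(1,-1)^{\perp}\subseteq\mathbb Q^{m+n}$, $N:=\mathbb Z^{m+n}/\mathbb Z(1,-1)$ and $N_{\mathbb Q}:=\mathbb Q^{m+n}/\mathbb Q(1,-1)$, with the induced pairing $\langle\cdot,\cdot\rangle\colon M_{\mathbb Q}\times N_{\mathbb Q}\to\mathbb Q$. The dual edge cone $\sigma_G^\vee\subseteq M_{\mathbb Q}$ is the cone generated by the vectors $e^i+f^j$ for the edges $(i,j)$ of $G$, and the edge cone is $\sigma_G:=\{a\in N_{\mathbb Q}\mid \langle x,a\rangle\ge 0 \text{ for all } x\in\sigma_G^\vee\}$. Let $\sigma_G^{(1)}$ be the set of extremal rays (one-dimensional faces) of $\sigma_G$; the extremal generators of $\sigma_G$ are the primitive generators of these rays, i.e. the generators of the semigroups $\rho\cap N$, $\rho\in\sigma_G^{(1)}$. For a face $\tau$ of $\sigma_G^\vee$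 let $\tau^*:=\tau^\perp\cap\sigma_G$. An independent set is a nonempty set $A\subseteq V$ without adjacent vertices; write $A_i:=A\cap U_i$, and let $N(A)$ be the set of vertices adjacent to some vertex of $A$. It is one-sided if $A\subseteq U_1$ or $A\subseteq U_2$, and two-sided if $\emptyset\ne A_i\subsetneq U_i$ for $i=1,2$. For $A\subseteq V$ put $\mathcal H_A:=\{x\in M_{\mathbb Q}\mid \sum_{v\in A}x_v=\sum_{v\in N(A)}x_v\}$. The spanning subgraph $G\{A\}$ of $G$ associated to an independent set $A$ is the disjoint union of the induced subgraphs $G[A\sqcup N(A)]$ and $G[(U_i\setminus A)\sqcup(U_j\setminus N(A))]$ if $A\subseteq U_i$ is one-sided, $\{i,j\}=\{1,2\}$, and of $G[A_1\sqcup N(A_1)]$ and $G[A_2\sqcup N(A_2)]$ if $A$ is two-sided, together with all remaining vertices of $G$ as isolated vertices. Let $\mathcal I_G^{(*)}$ be the set consisting of the two-sided maximal independent sets and of the independent sets of the form $U_i\setminus\{u\}$, $u\in U_i$, that are contained in no two-sided independent set. A first independent set is an $A\in\mathcal I_G^{(*)}$ such that $G\{A\}$ has exactly two connected components; $\mathcal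 I_G^{(1)}$ denotes the set of first independent sets. Then for every $A\in\mathcal I_G^{(1)}$ and every $i\in\{1,2\}$ with $A_i\neq\emptyset$ the set $\mathcal H_{A_i}\cap\sigma_G^\vee$ is a facet of $\sigma_G^\vee$, and $$\pi\colon\mathcal I_G^{(1)}\longrightarrow\sigma_G^{(1)},\qquad A\longmapsto(\mathcal H_{A_i}\cap\sigma_G^\vee)^*\quad(A_i\ne\emptyset)$$ is well defined (independent of the choice of $i$) and bijective. Sending $A$ to the primitive generator of the ray $\pi(A)$ is a bijection from $\mathcal I_G^{(1)}$ onto the set of extremal generators of $\sigma_G$. -/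

import Mathlib

namespace EdgeCone

noncomputable section

/-! ### The lattices and vector spaces -/

/-- The vertex set of `K_{m,n}`. -/
abbrev Vert (m n : ℕ) : Type := Fin m ⊕ Fin n

/-- The vector `(1,…,1,-1,…,-1) = ∑ e_i - ∑ f_j`. -/
def oneNegOne (m n : ℕ) : Vert m n → ℚ := Sum.elim (fun _ => 1) (fun _ => -1)

/-- `M_ℚ`: the orthogonal complement of `(1,-1)` in `ℚ^{m+n}`. -/
def MQ (m n : ℕ) : Submodule ℚ (Vert m n → ℚ) :=
  LinearMap.ker (dotProductBilin ℚ ℚ (oneNegOne m n))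

/-- The line spanned by `(1,-1)`. -/
def minLine (m n : ℕ) : Submodule ℚ (Vert m n → ℚ) := Submodule.span ℚ {oneNegOne m n}

/-- `N_ℚ = ℚ^{m+n} / ⟨(1,-1)⟩`. -/
abbrev NQ (m n : ℕ) : Type := (Vert m n → ℚ) ⧸ minLine m n

theorem minLine_le_ker (m n : ℕ) :
    minLine m n ≤ LinearMap.ker
      ((dotProductBilin ℚ ℚ : (Vert m n → ℚ) →ₗ[ℚ] (Vert m n → ℚ) →ₗ[ℚ] ℚ).compl₂
        (MQ m n).subtype) := by
  rw [minLine, Submodule.span_le, Set.singleton_subset_iff]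
  ext x
  exact x.2

/-- The pairing `M_ℚ × N_ℚ → ℚ` induced by the standard scalar product of `ℚ^{m+n}`. -/
def pairing (m n : ℕ) : MQ m n →ₗ[ℚ] NQ m n →ₗ[ℚ] ℚ :=
  ((minLine m n).liftQ
    ((dotProductBilin ℚ ℚ : (Vert m n → ℚ) →ₗ[ℚ] (Vert m n → ℚ) →ₗ[ℚ] ℚ).compl₂
      (MQ m n).subtype) (minLine_le_ker m n)).flip

theorem pairing_apply_mk {m n : ℕ} (x : MQ m n) (a : Vert m n → ℚ) :
    pairing m n x (Submodule.Quotient.mk a) = ∑ v, a v * (x : Vert m n → ℚ) v := rfl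

/-- The lattice `N = ℤ^{m+n} / ⟨(1,-1)⟩`, as a subgroup of `N_ℚ`. -/
def latticeN (m n : ℕ) : AddSubgroup (NQ m n) :=
  ((minLine m n).mkQ.toAddMonoidHom.comp
    ((Int.castAddHom ℚ).compLeft (Vert m n))).range

/-! ### The edge cone and its dual -/

theorem edgeVector_mem {m n : ℕ} (i : Fin m) (j : Fin n) :
    (Pi.single (Sum.inl i) 1 + Pi.single (Sum.inr j) 1 : Vert m n → ℚ) ∈ MQ m n := by
  simp [MQ, oneNegOne]

/-- The vector `e^i + f^j ∈ M_ℚ`. -/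
def edgeVector {m n : ℕ} (i : Fin m) (j : Fin n) : MQ m n :=
  ⟨Pi.single (Sum.inl i) 1 + Pi.single (Sum.inr j) 1, edgeVector_mem i j⟩

/-- The dual edge cone `σ_G^∨ ⊆ M_ℚ`. -/
def dualEdgeCone {m n : ℕ} (G : SimpleGraph (Vert m n)) : PointedCone ℚ (MQ m n) :=
  PointedCone.hull ℚ {x | ∃ i j, G.Adj (Sum.inl i) (Sum.inr j) ∧ x = edgeVector i j}

/-- The edge cone `σ_G ⊆ N_ℚ`. -/
def edgeCone {m n : ℕ} (G : SimpleGraph (Vert m n)) : PointedCone ℚ (NQ m n) :=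
  PointedCone.dual (pairing m n) (dualEdgeCone G : Set (MQ m n))

/-- The dimension of a cone: the dimension of its linear span. -/
def coneDim {E : Type*} [AddCommGroup E] [Module ℚ E] (C : PointedCone ℚ E) : ℕ :=
  Module.finrank ℚ (Submodule.span ℚ (C : Set E))

/-- `F` is a facet of `C`: a face of codimension one. -/
def IsFacet {E : Type*} [AddCommGroup E] [Module ℚ E] (F C : PointedCone ℚ E) : Prop :=
  F.IsFaceOf C ∧ coneDim F + 1 = coneDim C

/-- `σ_G^{(1)}`: the extremal rays of the edge cone, i.e. its one-dimensional faces. -/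
def extremalRays {m n : ℕ} (G : SimpleGraph (Vert m n)) : Set (PointedCone ℚ (NQ m n)) :=
  {ρ | ρ.IsFaceOf (edgeCone G) ∧ coneDim ρ = 1}

/-- `v` is the (primitive) generator of the ray `ρ`: it generates the semigroup `ρ ∩ N`. -/
def IsRayGenerator {m n : ℕ} (ρ : PointedCone ℚ (NQ m n)) (v : NQ m n) : Prop :=
  (ρ : Set (NQ m n)) ∩ (latticeN m n : Set (NQ m n)) = Set.range (fun k : ℕ => k • v)

/-- The extremal (ray) generators of the edge cone. -/
def extremalGenerators {m n : ℕ} (G : SimpleGraph (Vert m n)) : Set (NQ m n) :=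
  {v | ∃ ρ ∈ extremalRays G, IsRayGenerator ρ v}

/-- `τ^* = τ^⊥ ∩ σ_G` for `τ ⊆ σ_G^∨`. -/
def dualFace {m n : ℕ} (G : SimpleGraph (Vert m n)) (τ : PointedCone ℚ (MQ m n)) :
    PointedCone ℚ (NQ m n) :=
  PointedCone.ofSubmodule
    (⨅ x ∈ τ, LinearMap.ker (pairing m n x)) ⊓ edgeCone G

theorem mem_dualFace {m n : ℕ} {G : SimpleGraph (Vert m n)} {τ : PointedCone ℚ (MQ m n)}
    {a : NQ m n} : a ∈ dualFace G τ ↔ (∀ x ∈ τ, pairing m n x a = 0) ∧ a ∈ edgeCone G := by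
  simp [dualFace]

/-! ### Independent sets -/

/-- The two sides `U_1`, `U_2` of the bipartition, indexed by `0`, `1`. -/
def U {m n : ℕ} : Fin 2 → Set (Vert m n) := ![Set.range Sum.inl, Set.range Sum.inr]

/-- Independent sets are nonempty by convention. -/
def IsIndep {m n : ℕ} (G : SimpleGraph (Vert m n)) (A : Set (Vert m n)) : Prop :=
  A.Nonempty ∧ G.IsIndepSet A

/-- The neighbor set `N(A)`. -/
def nbr {m n : ℕ} (G : SimpleGraph (Vert m n)) (A : Set (Vert m n)) : Set (Vert m n) :=
  {v | ∃ a ∈ A, G.Adj a v}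

/-- The linear form `x ↦ ∑_{v ∈ A} x_v` on `M_ℚ`. -/
def sumOver {m n : ℕ} (A : Set (Vert m n)) : MQ m n →ₗ[ℚ] ℚ :=
  (dotProductBilin ℚ ℚ (A.indicator 1)).comp (MQ m n).subtype

/-- The hyperplane `ℋ_A = {x ∈ M_ℚ | ∑_{v ∈ A} x_v = ∑_{v ∈ N(A)} x_v}`. -/
def hyperplane {m n : ℕ} (G : SimpleGraph (Vert m n)) (A : Set (Vert m n)) :
    Submodule ℚ (MQ m n) :=
  LinearMap.eqLocus (sumOver A) (sumOver (nbr G A))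

/-- `ℋ_A ∩ σ_G^∨`. -/
def hyperplaneFace {m n : ℕ} (G : SimpleGraph (Vert m n)) (A : Set (Vert m n)) :
    PointedCone ℚ (MQ m n) :=
  PointedCone.ofSubmodule (hyperplane G A) ⊓ dualEdgeCone G

/-- Two-sided independent sets: both `A ∩ U_i` are nonempty and proper in `U_i`. -/
def IsTwoSided {m n : ℕ} (G : SimpleGraph (Vert m n)) (A : Set (Vert m n)) : Prop :=
  IsIndep G A ∧ ∀ i, (A ∩ U i).Nonempty ∧ A ∩ U i ⊂ U i

/-- `G[S]` as a graph on all vertices (those outside `S` are isolated). -/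
def inducedOn {m n : ℕ} (G : SimpleGraph (Vert m n)) (S : Set (Vert m n)) :
    SimpleGraph (Vert m n) :=
  (G.induce S).spanningCoe

open Classical in
/-- The spanning subgraph `G{A}` associated to an independent set `A`. -/
def assocSubgraph {m n : ℕ} (G : SimpleGraph (Vert m n)) (A : Set (Vert m n)) :
    SimpleGraph (Vert m n) :=
  if A ⊆ U 0 then
    inducedOn G (A ∪ nbr G A) ⊔ inducedOn G ((U 0 \ A) ∪ (U 1 \ nbr G A))
  else if A ⊆ U 1 then
    inducedOn G (A ∪ nbr G A) ⊔ inducedOn G ((U 1 \ A) ∪ (U 0 \ nbr G A))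
  else
    inducedOn G ((A ∩ U 0) ∪ nbr G (A ∩ U 0)) ⊔ inducedOn G ((A ∩ U 1) ∪ nbr G (A ∩ U 1))

/-- `ℐ_G^{(*)}`: the two-sided maximal independent sets, and the (one-sided) independent sets
`U_i \ {u}` that are not contained in any two-sided independent set. -/
def starIndependentSets {m n : ℕ} (G : SimpleGraph (Vert m n)) : Set (Set (Vert m n)) :=
  {A | IsTwoSided G A ∧ Maximal (IsIndep G) A} ∪
  {A | IsIndep G A ∧ (∃ i, ∃ u ∈ U i, A = U i \ {u}) ∧ ¬ ∃ B, IsTwoSided G B ∧ A ⊆ B}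

/-- `ℐ_G^{(1)}`: the first independent sets. -/
def firstIndependentSets {m n : ℕ} (G : SimpleGraph (Vert m n)) : Set (Set (Vert m n)) :=
  {A ∈ starIndependentSets G | Nat.card (assocSubgraph G A).ConnectedComponent = 2}

end

end EdgeCone

/-!
After reversing the signs on the second side, a point of `N_ℚ` is a potential on the vertices modulo
constants, and it lies in `σ_G` if and only if the potential does not increase along the edges,
directed from the first to the second side. It spans an extremal ray if and only if the inequalities
that are tight at it determine it up to scaling. A strict superlevel set of such a potential has an
indicator function that is constant wherever the potential is, so this indicator function spans the
same ray. Hence the extremal rays are spanned by the indicator functions of the vertex sets `C` such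
that no edge enters `C` and both `C` and its complement are connected (directed bonds); these
functions are primitive, and distinct because they take both values `0` and `1`.

A vertex set `A` corresponds to `C = (U_1 \ A) ∪ (A ∩ U_2)`. No edge enters `C` if and only if no
edge has both ends in `A`, and the edges inside the two parts are those with exactly one end in `A`.
For `A ∈ ℐ_G^{(*)}` the neighbors of a nonempty side of `A` are all the vertices outside `A` on the
other side; therefore `G{A}` consists of the two parts of the partition, and each `ℋ_{A_i}` is the
hyperplane orthogonal to the indicator function of `C`.
-/

namespace EdgeCone

open PointedCone

/-! ### Tight constraints of polyhedral cones -/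

theorem mem_span_of_forall_eq_zero {K E F : Type*} [Field K] [AddCommGroup E] [Module K E]
    [AddCommGroup F] [Module K F] {B : E →ₗ[K] F →ₗ[K] K} (hB : Function.Surjective B.flip)
    {S : Set E} {x : E} (h : ∀ z, (∀ s ∈ S, B s z = 0) → B x z = 0) : x ∈ Submodule.span K S := by
  by_contra hx
  obtain ⟨f, hfx, hf⟩ := Submodule.exists_le_ker_of_notMem hx
  obtain ⟨z, rfl⟩ := hB f
  exact hfx (h z fun s hs => hf (Submodule.subset_span hs))

section OrderedField

variable {K E F : Type*} [Field K] [LinearOrder K] [IsStrictOrderedRing K]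
  [AddCommGroup E] [Module K E] [AddCommGroup F] [Module K F]

theorem exists_forall_abs_le_mul {ι : Type*} [Finite ι] {a b : ι → K} (ha : ∀ i, 0 ≤ a i)
    (hab : ∀ i, a i = 0 → b i = 0) : ∃ c, 0 ≤ c ∧ ∀ i, |b i| ≤ c * a i := by
  cases nonempty_fintype ι
  have hnonneg : ∀ i, 0 ≤ |b i| / a i := fun i => div_nonneg (abs_nonneg _) (ha i)
  refine ⟨∑ i, |b i| / a i, Finset.sum_nonneg fun i _ => hnonneg i, fun i => ?_⟩
  rcases (ha i).eq_or_lt' with hi | hi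
  · simp [hi, hab i hi]
  · exact (div_le_iff₀ hi).1 (Finset.single_le_sum (fun i _ => hnonneg i) (Finset.mem_univ i))

theorem mem_hull_singleton {x y : E} : y ∈ hull K {x} ↔ ∃ c : K, 0 ≤ c ∧ c • x = y := by
  rw [hull, Submodule.mem_span_singleton]
  exact ⟨fun ⟨c, hc⟩ => ⟨c, c.2, hc⟩, fun ⟨c, hc, h⟩ => ⟨⟨c, hc⟩, h⟩⟩

theorem eq_zero_of_mul_add_eq_zero {a u v : K} (ha : 0 < a) (hu : 0 ≤ u) (hv : 0 ≤ v)
    (h : a * u + v = 0) : u = 0 :=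
  (mul_eq_zero.1 ((add_eq_zero_iff_of_nonneg (mul_nonneg ha.le hu) hv).1 h).1).resolve_left ha.ne'

theorem isFaceOf_ker_inf {C : PointedCone K E} {f : E →ₗ[K] K} (hf : ∀ x ∈ C, 0 ≤ f x) :
    (ofSubmodule (LinearMap.ker f) ⊓ C).IsFaceOf C := by
  refine ⟨inf_le_right, fun {x y a} hx hy ha hxy => ⟨?_, hx⟩⟩
  exact eq_zero_of_mul_add_eq_zero ha (hf x hx) (hf y hy) (by simpa using hxy.1)

variable {B : E →ₗ[K] F →ₗ[K] K} {S : Set E} {y z : F}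

theorem mem_hull_singleton_of_mem_span (hS : ∀ z, (∀ s ∈ S, B s z = 0) → z = 0)
    (hy : y ∈ dual B S) (hz : z ∈ dual B S) (h : z ∈ Submodule.span K {y}) : z ∈ hull K {y} := by
  obtain ⟨c, rfl⟩ := Submodule.mem_span_singleton.1 h
  rcases le_or_gt 0 c with hc | hc
  · exact mem_hull_singleton.2 ⟨c, hc, rfl⟩
  · have hy0 : y = 0 := hS y fun s hs => by
      have hcy : 0 ≤ c * B s y := by simpa using hz hs
      exact le_antisymm (nonpos_of_mul_nonneg_right hcy hc) (hy hs)
    simp [hy0]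

/-- `y` is determined up to scaling by those constraints `⟨s, ·⟩ ≥ 0`, `s ∈ S`, that are tight at
`y`. For a nonzero point `y` of the cone dual to a finite set `S` this means that `y` spans an
extremal ray. -/
def IsTightlyDetermined (B : E →ₗ[K] F →ₗ[K] K) (S : Set E) (y : F) : Prop :=
  ∀ z, (∀ s ∈ S, B s y = 0 → B s z = 0) → z ∈ Submodule.span K {y}

namespace IsTightlyDetermined

theorem mem_hull_singleton_iff (h : IsTightlyDetermined B S y)
    (hS : ∀ z, (∀ s ∈ S, B s z = 0) → z = 0) (hy : y ∈ dual B S) :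
    z ∈ hull K {y} ↔ z ∈ dual B S ∧ ∀ s ∈ S, B s y = 0 → B s z = 0 := by
  constructor
  · intro hz
    obtain ⟨c, hc, rfl⟩ := mem_hull_singleton.1 hz
    exact ⟨smul_mem _ hc hy, fun s _ hs => by simp [hs]⟩
  · rintro ⟨hz, htight⟩
    exact mem_hull_singleton_of_mem_span hS hy hz (h z htight)

theorem isFaceOf_hull_singleton (h : IsTightlyDetermined B S y)
    (hS : ∀ z, (∀ s ∈ S, B s z = 0) → z = 0) (hy : y ∈ dual B S) :
    (hull K {y}).IsFaceOf (dual B S) := by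
  refine ⟨fun z hz => ((h.mem_hull_singleton_iff hS hy).1 hz).1, fun {x w a} hx hw ha hxw => ?_⟩
  refine (h.mem_hull_singleton_iff hS hy).2 ⟨hx, fun s hs hsy => ?_⟩
  have htight := ((h.mem_hull_singleton_iff hS hy).1 hxw).2 s hs hsy
  exact eq_zero_of_mul_add_eq_zero ha (hx hs) (hw hs) (by simpa using htight)

theorem span_ker_flip_inf_hull (h : IsTightlyDetermined B S y)
    (hB : Function.Surjective B.flip) :
    Submodule.span K ((ofSubmodule (LinearMap.ker (B.flip y)) ⊓ hull K S : PointedCone K E) : Set E)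
      = LinearMap.ker (B.flip y) := by
  refine le_antisymm (Submodule.span_le.2 fun x hx => hx.1) fun x hx =>
    mem_span_of_forall_eq_zero hB fun z hz => ?_
  obtain ⟨c, rfl⟩ := Submodule.mem_span_singleton.1
    (h z fun s hs hsy => hz s ⟨hsy, subset_hull hs⟩)
  rw [map_smul, show B x y = 0 from hx, smul_zero]

end IsTightlyDetermined

end OrderedField

section ConeDim

variable {E F : Type*} [AddCommGroup E] [Module ℚ E] [AddCommGroup F] [Module ℚ F]

theorem coneDim_hull_singleton {x : E} (hx : x ≠ 0) : coneDim (hull ℚ {x}) = 1 := by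
  rw [coneDim, hull, Submodule.span_span_of_tower, finrank_span_singleton hx]

theorem exists_mem_ne_zero_of_coneDim_eq_one {ρ : PointedCone ℚ E} (h : coneDim ρ = 1) :
    ∃ x ∈ ρ, x ≠ 0 := by
  by_contra! h0
  rw [coneDim, Submodule.span_eq_bot.2 h0, finrank_bot] at h
  exact zero_ne_one h

theorem mem_span_singleton_of_coneDim_eq_one {ρ : PointedCone ℚ E} (h : coneDim ρ = 1) {x y : E}
    (hx : x ∈ ρ) (hx0 : x ≠ 0) (hy : y ∈ ρ) : y ∈ Submodule.span ℚ {x} := by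
  have hx' : x ∈ Submodule.span ℚ (ρ : Set E) := Submodule.subset_span hx
  obtain ⟨c, hc⟩ := (finrank_eq_one_iff_of_nonzero' ⟨x, hx'⟩ (by simpa using hx0)).1 h
    ⟨y, Submodule.subset_span hy⟩
  exact Submodule.mem_span_singleton.2 ⟨c, congrArg Subtype.val hc⟩

variable {B : E →ₗ[ℚ] F →ₗ[ℚ] ℚ} {S : Set E} {y : F} {ρ : PointedCone ℚ F}

theorem eq_hull_singleton_of_coneDim_eq_one (hS : ∀ z, (∀ s ∈ S, B s z = 0) → z = 0)
    (hρ : ρ ≤ dual B S) (hdim : coneDim ρ = 1) (hy : y ∈ ρ) (hy0 : y ≠ 0) : ρ = hull ℚ {y} :=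
  le_antisymm
    (fun _ hz => mem_hull_singleton_of_mem_span hS (hρ hy) (hρ hz)
      (mem_span_singleton_of_coneDim_eq_one hdim hy hy0 hz))
    (Submodule.span_le.2 (Set.singleton_subset_iff.2 hy))

theorem isTightlyDetermined_of_coneDim_eq_one (hS : S.Finite) (hρ : ρ.IsFaceOf (dual B S))
    (hdim : coneDim ρ = 1) (hy : y ∈ ρ) (hy0 : y ≠ 0) : IsTightlyDetermined B S y := by
  intro z hz
  have := hS.to_subtype
  -- The segment from `c • y - z` to `c • y + z` lies in the dual cone, and its midpoint in `ρ`.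
  obtain ⟨c, hc, hle⟩ := exists_forall_abs_le_mul (ι := S) (a := fun s => B s y)
    (b := fun s => B s z) (fun s => hρ.le hy s.2) fun s => hz s s.2
  have hadd : c • y + z ∈ dual B S := fun s hs => by
    simpa [neg_le_iff_add_nonneg'] using (abs_le.1 (hle ⟨s, hs⟩)).1
  have hsub : c • y - z ∈ dual B S := fun s hs => by
    simpa using (abs_le.1 (hle ⟨s, hs⟩)).2
  have hmem : c • y + z ∈ ρ := by
    refine hρ.mem_of_add_mem_left hadd hsub ?_
    rw [add_add_sub_cancel]
    exact add_mem (smul_mem _ hc hy) (smul_mem _ hc hy)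
  exact (Submodule.add_mem_iff_right _
    (Submodule.smul_mem _ c (Submodule.mem_span_singleton_self y))).1
      (mem_span_singleton_of_coneDim_eq_one hdim hy hy0 hmem)

theorem IsTightlyDetermined.isFacet_ker_flip_inf_hull [FiniteDimensional ℚ E]
    (h : IsTightlyDetermined B S y) (hB : Function.Surjective B.flip)
    (hS : ∀ z, (∀ s ∈ S, B s z = 0) → z = 0) (hy : y ∈ dual B S) (hy0 : y ≠ 0) :
    IsFacet (ofSubmodule (LinearMap.ker (B.flip y)) ⊓ hull ℚ S) (hull ℚ S) := by
  have hspan : Submodule.span ℚ (hull ℚ S : Set E) = ⊤ := by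
    rw [hull, Submodule.span_span_of_tower]
    exact eq_top_iff.2 fun x _ => mem_span_of_forall_eq_zero hB fun z hz => by simp [hS z hz]
  have hflip : B.flip y ≠ 0 := fun h0 => hy0 (hS y fun s _ => LinearMap.congr_fun h0 s)
  rw [← dual_hull] at hy
  refine ⟨isFaceOf_ker_inf hy, ?_⟩
  rw [coneDim, coneDim, h.span_ker_flip_inf_hull hB, hspan, finrank_top,
    Module.Dual.finrank_ker_add_one_of_ne_zero hflip]

end ConeDim

/-! ### Points of `N_ℚ` as potentials on the vertices -/

section Potential

variable {m n : ℕ} {G : SimpleGraph (Vert m n)} {p q : Vert m n → ℚ}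

/-- The class in `N_ℚ` of a potential `p` on the vertices, with the signs on the second side
reversed: in these coordinates the line spanned by `(1,-1)` consists of the constant potentials,
and the edge cone of the potentials that do not increase from the first to the second end of an
edge. -/
def potentialClass (m n : ℕ) : (Vert m n → ℚ) →ₗ[ℚ] NQ m n :=
  (minLine m n).mkQ.comp (LinearMap.mulLeft ℚ (oneNegOne m n))

theorem oneNegOne_mul_self (m n : ℕ) : oneNegOne m n * oneNegOne m n = 1 := by
  ext v
  cases v <;> simp [oneNegOne]

theorem mk_eq_potentialClass (a : Vert m n → ℚ) :
    Submodule.Quotient.mk a = potentialClass m n (oneNegOne m n * a) := by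
  simp [potentialClass, ← mul_assoc, oneNegOne_mul_self]

theorem potentialClass_surjective : Function.Surjective (potentialClass m n) := fun x => by
  obtain ⟨a, rfl⟩ := Submodule.Quotient.mk_surjective _ x
  exact ⟨_, (mk_eq_potentialClass a).symm⟩

theorem potentialClass_eq_zero_iff : potentialClass m n p = 0 ↔ ∃ c : ℚ, ∀ v, p v = c := by
  have hmul (c : ℚ) : c • oneNegOne m n = oneNegOne m n * p ↔ ∀ v, p v = c := by
    refine funext_iff.trans (forall_congr' fun v => ?_)
    cases v <;> simp [oneNegOne, eq_comm]
  rw [potentialClass, LinearMap.comp_apply, Submodule.mkQ_apply, Submodule.Quotient.mk_eq_zero,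
    minLine, Submodule.mem_span_singleton, LinearMap.mulLeft_apply]
  exact exists_congr hmul

theorem potentialClass_eq_iff :
    potentialClass m n p = potentialClass m n q ↔ ∃ c : ℚ, ∀ v, p v = q v + c := by
  rw [← sub_eq_zero, ← map_sub, potentialClass_eq_zero_iff]
  simp [sub_eq_iff_eq_add']

theorem potentialClass_mem_span_singleton_iff :
    potentialClass m n q ∈ Submodule.span ℚ {potentialClass m n p} ↔
      ∃ c d : ℚ, ∀ v, q v = c * p v + d := by
  simp_rw [Submodule.mem_span_singleton, ← map_smul, eq_comm (b := potentialClass m n q),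
    potentialClass_eq_iff, Pi.smul_apply, smul_eq_mul]

theorem potentialClass_mem_latticeN_iff :
    potentialClass m n p ∈ latticeN m n ↔ ∃ (z : Vert m n → ℤ) (c : ℚ), ∀ v, p v = z v + c := by
  have hsign (z : Vert m n → ℤ) : ∃ z' : Vert m n → ℤ, ∀ v, oneNegOne m n v * z v = z' v :=
    ⟨Sum.elim (fun i => z (.inl i)) fun j => -z (.inr j), by rintro (i | j) <;> simp [oneNegOne]⟩
  constructor
  · rintro ⟨z, hz⟩
    obtain ⟨z', hz'⟩ := hsign z
    obtain ⟨c, hc⟩ := potentialClass_eq_iff.1 (hz.symm.trans (mk_eq_potentialClass _))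
    exact ⟨z', c, fun v => by rw [hc, ← hz']; rfl⟩
  · rintro ⟨z, c, hc⟩
    obtain ⟨z', hz'⟩ := hsign z
    refine ⟨z', (mk_eq_potentialClass _).trans (potentialClass_eq_iff.2 ⟨-c, fun v => ?_⟩)⟩
    have hv := congrFun (oneNegOne_mul_self m n) v
    simp only [Pi.mul_apply, Pi.one_apply] at hv
    simp [hc, ← hz', ← mul_assoc, hv]

theorem pairing_edgeVector (i : Fin m) (j : Fin n) (p : Vert m n → ℚ) :
    pairing m n (edgeVector i j) (potentialClass m n p) = p (.inl i) - p (.inr j) := by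
  change ∑ v, (oneNegOne m n v * p v) * (Pi.single (.inl i) 1 + Pi.single (.inr j) 1 : _ → ℚ) v = _
  simp [oneNegOne, Pi.single_apply, sub_eq_add_neg]

theorem pairing_flip_surjective (m n : ℕ) : Function.Surjective (pairing m n).flip := fun f => by
  obtain ⟨g, rfl⟩ := LinearMap.exists_extend f
  obtain ⟨a, rfl⟩ := (dotProductEquiv ℚ (Vert m n)).surjective g
  exact ⟨Submodule.Quotient.mk a, rfl⟩

/-- The generators `e^i + f^j` of the dual edge cone. -/
def edgeVectors (G : SimpleGraph (Vert m n)) : Set (MQ m n) :=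
  {x | ∃ i j, G.Adj (.inl i) (.inr j) ∧ x = edgeVector i j}

theorem finite_edgeVectors (G : SimpleGraph (Vert m n)) : (edgeVectors G).Finite := by
  refine (Set.finite_range fun e : Fin m × Fin n => edgeVector e.1 e.2).subset ?_
  rintro _ ⟨i, j, -, rfl⟩
  exact ⟨(i, j), rfl⟩

theorem edgeCone_eq_dual (G : SimpleGraph (Vert m n)) :
    edgeCone G = dual (pairing m n) (edgeVectors G) :=
  dual_hull _

theorem potentialClass_mem_edgeCone_iff :
    potentialClass m n p ∈ edgeCone G ↔
      ∀ i j, G.Adj (.inl i) (.inr j) → p (.inr j) ≤ p (.inl i) := by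
  simp only [edgeCone_eq_dual, mem_dual, edgeVectors, Set.mem_ofPred_eq]
  refine ⟨fun h i j hij => ?_, ?_⟩
  · simpa [pairing_edgeVector] using h ⟨i, j, hij, rfl⟩
  · rintro h _ ⟨i, j, hij, rfl⟩
    simpa [pairing_edgeVector] using h i j hij

theorem exists_eq_inl_inr_of_adj (hG : G ≤ completeBipartiteGraph (Fin m) (Fin n))
    {u v : Vert m n} (h : G.Adj u v) :
    ∃ i j, (u = .inl i ∧ v = .inr j) ∨ (u = .inr j ∧ v = .inl i) := by
  have := hG h
  rcases u with i | j <;> rcases v with i' | j' <;> simp_all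

theorem forall_adj_iff (hG : G ≤ completeBipartiteGraph (Fin m) (Fin n))
    {r : Vert m n → Vert m n → Prop} (hr : ∀ u v, r u v → r v u) :
    (∀ i j, G.Adj (.inl i) (.inr j) → r (.inl i) (.inr j)) ↔ ∀ u v, G.Adj u v → r u v := by
  refine ⟨fun h u v huv => ?_, fun h i j => h _ _⟩
  obtain ⟨i, j, ⟨rfl, rfl⟩ | ⟨rfl, rfl⟩⟩ := exists_eq_inl_inr_of_adj hG huv
  · exact h i j huv
  · exact hr _ _ (h i j huv.symm)

theorem isTightlyDetermined_potentialClass_iff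
    (hG : G ≤ completeBipartiteGraph (Fin m) (Fin n)) :
    IsTightlyDetermined (pairing m n) (edgeVectors G) (potentialClass m n p) ↔
      ∀ q : Vert m n → ℚ, (∀ u v, G.Adj u v → p u = p v → q u = q v) →
        ∃ c d : ℚ, ∀ v, q v = c * p v + d := by
  refine potentialClass_surjective.forall.trans (forall_congr' fun q => ?_)
  rw [potentialClass_mem_span_singleton_iff,
    ← forall_adj_iff hG fun u v h hp => (h hp.symm).symm]
  refine imp_congr_left ⟨fun h i j hij => ?_, ?_⟩
  · simpa [pairing_edgeVector, sub_eq_zero] using h _ ⟨i, j, hij, rfl⟩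
  · rintro h _ ⟨i, j, hij, rfl⟩
    simpa [pairing_edgeVector, sub_eq_zero] using h i j hij

theorem apply_eq_of_reachable {V α : Type*} {H : SimpleGraph V} {f : V → α}
    (h : ∀ u v, H.Adj u v → f u = f v) {u v : V} (huv : H.Reachable u v) : f u = f v := by
  obtain ⟨w⟩ := huv
  induction w with
  | nil => rfl
  | cons hadj _ ih => exact (h _ _ hadj).trans ih

theorem eq_zero_of_forall_pairing_edgeVectors_eq_zero
    (hG : G ≤ completeBipartiteGraph (Fin m) (Fin n)) (hconn : G.Connected) (x : NQ m n)
    (h : ∀ s ∈ edgeVectors G, pairing m n s x = 0) : x = 0 := by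
  obtain ⟨p, rfl⟩ := potentialClass_surjective x
  obtain ⟨v₀⟩ := hconn.nonempty
  have hp : ∀ u v, G.Adj u v → p u = p v := (forall_adj_iff hG fun _ _ => Eq.symm).1
    fun i j hij => by simpa [pairing_edgeVector, sub_eq_zero] using h _ ⟨i, j, hij, rfl⟩
  exact potentialClass_eq_zero_iff.2
    ⟨p v₀, fun v => apply_eq_of_reachable hp (hconn.preconnected v v₀)⟩

end Potential

/-! ### Directed bonds -/

section DeleteCut

variable {V : Type*} {G : SimpleGraph V} {C : Set V}

theorem exists_adj_of_reachable_of_ne {u v : V} (h : G.Reachable u v) (huv : u ≠ v) :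
    ∃ w, G.Adj u w := by
  obtain ⟨w⟩ := h
  cases w with
  | nil => exact absurd rfl huv
  | cons hadj _ => exact ⟨_, hadj⟩

/-- The graph obtained from `G` by deleting the edges between `C` and its complement. -/
def deleteCut (G : SimpleGraph V) (C : Set V) : SimpleGraph V where
  Adj u v := G.Adj u v ∧ (u ∈ C ↔ v ∈ C)
  symm := ⟨fun _ _ h => ⟨h.1.symm, h.2.symm⟩⟩
  loopless := ⟨fun _ h => G.irrefl h.1⟩

theorem mem_iff_of_reachable_deleteCut {u v : V} (h : (deleteCut G C).Reachable u v) :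
    u ∈ C ↔ v ∈ C :=
  iff_of_eq (apply_eq_of_reachable (f := (· ∈ C)) (fun _ _ (huv : _ ∧ _) => propext huv.2) h)

theorem card_connectedComponent_deleteCut_eq_two_iff (hC : C.Nonempty) (hC' : Cᶜ.Nonempty) :
    Nat.card (deleteCut G C).ConnectedComponent = 2 ↔
      ∀ u v, (u ∈ C ↔ v ∈ C) → (deleteCut G C).Reachable u v := by
  let side : (deleteCut G C).ConnectedComponent → Prop :=
    SimpleGraph.ConnectedComponent.lift (· ∈ C) fun _ _ w _ =>
      propext (mem_iff_of_reachable_deleteCut w.reachable)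
  have hsurj : Function.Surjective side := fun P => by
    obtain ⟨u, hu⟩ := hC
    obtain ⟨v, hv⟩ := hC'
    by_cases hP : P
    · exact ⟨SimpleGraph.connectedComponentMk _ u, propext (iff_of_true hu hP)⟩
    · exact ⟨SimpleGraph.connectedComponentMk _ v, propext (iff_of_false hv hP)⟩
  have hProp : Nat.card Prop = 2 := by simp
  have hinj : Function.Injective side ↔
      ∀ u v, (u ∈ C ↔ v ∈ C) → (deleteCut G C).Reachable u v := by
    refine Quot.mk_surjective.forall₂.trans (forall₂_congr fun u v => ?_)
    exact imp_congr eq_iff_iff SimpleGraph.ConnectedComponent.eq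
  rw [← hinj]
  constructor
  · intro h
    have : Finite (deleteCut G C).ConnectedComponent := Nat.finite_of_card_ne_zero (by simp [h])
    exact (hsurj.bijective_of_nat_card_le (h.trans hProp.symm).le).1
  · exact fun h => (Nat.card_eq_of_bijective side ⟨h, hsurj⟩).trans hProp

end DeleteCut

section DirectedBond

variable {m n : ℕ} {G : SimpleGraph (Vert m n)} {C D : Set (Vert m n)}

/-- A directed bond of `G`: a partition of the vertices into two parts `C` and `Cᶜ`, each inducing a
connected subgraph, such that the edges between the parts all lead from the first side of `C` to
the second side of `Cᶜ`. -/
structure IsDirectedBond (G : SimpleGraph (Vert m n)) (C : Set (Vert m n)) : Prop where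
  nonempty : C.Nonempty
  nonempty_compl : Cᶜ.Nonempty
  directed : ∀ i j, G.Adj (.inl i) (.inr j) → .inr j ∈ C → .inl i ∈ C
  reachable : ∀ u v, (u ∈ C ↔ v ∈ C) → (deleteCut G C).Reachable u v

/-- The class in `N_ℚ` of the indicator function of `C`. -/
noncomputable def cutVector (C : Set (Vert m n)) : NQ m n :=
  potentialClass m n (C.indicator 1)

/-- The ray spanned by `cutVector C`. -/
noncomputable def cutRay (C : Set (Vert m n)) : PointedCone ℚ (NQ m n) :=
  hull ℚ {cutVector C}

theorem indicator_one_eq_indicator_one_iff {V : Type*} {C : Set V} {u v : V} :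
    C.indicator (1 : V → ℚ) u = C.indicator 1 v ↔ (u ∈ C ↔ v ∈ C) := by
  by_cases hu : u ∈ C <;> by_cases hv : v ∈ C <;> simp [hu, hv]

theorem cutVector_injOn :
    {C : Set (Vert m n) | C.Nonempty ∧ Cᶜ.Nonempty}.InjOn cutVector := by
  rintro C ⟨⟨u, hu⟩, ⟨w, hw⟩⟩ D - h
  obtain ⟨c, hc⟩ := potentialClass_eq_iff.1 h
  have hu' : D.indicator 1 u ≤ (1 : ℚ) := Set.indicator_le_self' (fun _ _ => zero_le_one) u
  have hw' : 0 ≤ D.indicator (1 : Vert m n → ℚ) w := Set.indicator_nonneg (fun _ _ => zero_le_one) w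
  have hcu : 1 = D.indicator 1 u + c := by simpa [hu] using hc u
  have hcw : 0 = D.indicator 1 w + c := by simpa [Set.notMem_of_mem_compl hw] using hc w
  have hc0 : c = 0 := by linarith
  refine Set.indicator_one_inj ℚ (funext fun v => ?_)
  rw [hc v, hc0, add_zero]

theorem cutVector_ne_zero (hC : C.Nonempty) (hC' : Cᶜ.Nonempty) : cutVector C ≠ 0 := by
  obtain ⟨u, hu⟩ := hC
  obtain ⟨w, hw⟩ := hC'
  intro h
  obtain ⟨c, hc⟩ := potentialClass_eq_zero_iff.1 h
  have huw := indicator_one_eq_indicator_one_iff.1 ((hc u).trans (hc w).symm)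
  exact hw (huw.1 hu)

theorem cutVector_mem_edgeCone_iff : cutVector C ∈ edgeCone G ↔
    ∀ i j, G.Adj (.inl i) (.inr j) → .inr j ∈ C → .inl i ∈ C := by
  refine potentialClass_mem_edgeCone_iff.trans (forall₃_congr fun i j _ => ?_)
  by_cases hi : .inl i ∈ C <;> by_cases hj : .inr j ∈ C <;> simp [hi, hj]

theorem isTightlyDetermined_cutVector_iff (hG : G ≤ completeBipartiteGraph (Fin m) (Fin n))
    (hC : C.Nonempty) (hC' : Cᶜ.Nonempty) :
    IsTightlyDetermined (pairing m n) (edgeVectors G) (cutVector C) ↔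
      ∀ u v, (u ∈ C ↔ v ∈ C) → (deleteCut G C).Reachable u v := by
  rw [cutVector, isTightlyDetermined_potentialClass_iff hG]
  simp_rw [indicator_one_eq_indicator_one_iff]
  constructor
  · intro h u v huv
    obtain ⟨c, d, hcd⟩ := h ({w | (deleteCut G C).Reachable u w}.indicator 1) fun x y hxy hside =>
      indicator_one_eq_indicator_one_iff.2
        ⟨fun hx => hx.trans (SimpleGraph.Adj.reachable ⟨hxy, hside⟩),
          fun hy => hy.trans (SimpleGraph.Adj.reachable ⟨hxy.symm, hside.symm⟩)⟩
    have hmem := indicator_one_eq_indicator_one_iff.1 ((hcd u).trans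
      ((congrArg (c * · + d) (indicator_one_eq_indicator_one_iff.2 huv)).trans (hcd v).symm))
    exact hmem.1 (SimpleGraph.Reachable.refl u)
  · intro h q hq
    obtain ⟨u, hu⟩ := hC
    obtain ⟨w, hw⟩ := hC'
    have hconst {x y : Vert m n} (hxy : x ∈ C ↔ y ∈ C) : q x = q y :=
      apply_eq_of_reachable (fun a b (hab : _ ∧ _) => hq a b hab.1 hab.2) (h x y hxy)
    refine ⟨q u - q w, q w, fun v => ?_⟩
    by_cases hv : v ∈ C
    · simp [hv, hconst (iff_of_true hv hu)]
    · simp [hv, hconst (iff_of_false hv hw)]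

namespace IsDirectedBond

theorem cutVector_ne_zero (h : IsDirectedBond G C) : cutVector C ≠ 0 :=
  EdgeCone.cutVector_ne_zero h.nonempty h.nonempty_compl

theorem cutVector_mem_dual (h : IsDirectedBond G C) :
    cutVector C ∈ dual (pairing m n) (edgeVectors G) :=
  edgeCone_eq_dual G ▸ cutVector_mem_edgeCone_iff.2 h.directed

theorem isTightlyDetermined (h : IsDirectedBond G C)
    (hG : G ≤ completeBipartiteGraph (Fin m) (Fin n)) :
    IsTightlyDetermined (pairing m n) (edgeVectors G) (cutVector C) :=
  (isTightlyDetermined_cutVector_iff hG h.nonempty h.nonempty_compl).2 h.reachable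

theorem cutRay_mem_extremalRays (h : IsDirectedBond G C)
    (hG : G ≤ completeBipartiteGraph (Fin m) (Fin n)) (hconn : G.Connected) :
    cutRay C ∈ extremalRays G := by
  refine ⟨?_, coneDim_hull_singleton h.cutVector_ne_zero⟩
  rw [edgeCone_eq_dual]
  exact (h.isTightlyDetermined hG).isFaceOf_hull_singleton
    (eq_zero_of_forall_pairing_edgeVectors_eq_zero hG hconn) h.cutVector_mem_dual

theorem isFacet_ker_flip_inf_dualEdgeCone (h : IsDirectedBond G C)
    (hG : G ≤ completeBipartiteGraph (Fin m) (Fin n)) (hconn : G.Connected) :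
    IsFacet (ofSubmodule (LinearMap.ker ((pairing m n).flip (cutVector C))) ⊓ dualEdgeCone G)
      (dualEdgeCone G) :=
  (h.isTightlyDetermined hG).isFacet_ker_flip_inf_hull (pairing_flip_surjective m n)
    (eq_zero_of_forall_pairing_edgeVectors_eq_zero hG hconn) h.cutVector_mem_dual
    h.cutVector_ne_zero

theorem dualFace_ker_flip_inf_dualEdgeCone (h : IsDirectedBond G C)
    (hG : G ≤ completeBipartiteGraph (Fin m) (Fin n)) (hconn : G.Connected) :
    dualFace G
      (ofSubmodule (LinearMap.ker ((pairing m n).flip (cutVector C))) ⊓ dualEdgeCone G) =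
        cutRay C := by
  ext a
  rw [mem_dualFace]
  constructor
  · rintro ⟨h0, ha⟩
    rw [edgeCone_eq_dual] at ha
    exact ((h.isTightlyDetermined hG).mem_hull_singleton_iff
      (eq_zero_of_forall_pairing_edgeVectors_eq_zero hG hconn) h.cutVector_mem_dual).2
        ⟨ha, fun s hs hsy => h0 s ⟨hsy, subset_hull hs⟩⟩
  · intro ha
    refine ⟨fun x hx => ?_, (h.cutRay_mem_extremalRays hG hconn).1.le ha⟩
    obtain ⟨c, -, rfl⟩ := mem_hull_singleton.1 ha
    rw [map_smul, show pairing m n x (cutVector C) = 0 from hx.1, smul_zero]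

end IsDirectedBond

theorem exists_isDirectedBond_of_mem_extremalRays
    (hG : G ≤ completeBipartiteGraph (Fin m) (Fin n)) (hconn : G.Connected)
    {ρ : PointedCone ℚ (NQ m n)} (hρ : ρ ∈ extremalRays G) :
    ∃ C, IsDirectedBond G C ∧ cutRay C = ρ := by
  have ⟨hface, hdim⟩ := hρ
  rw [edgeCone_eq_dual] at hface
  obtain ⟨x, hx, hx0⟩ := exists_mem_ne_zero_of_coneDim_eq_one hdim
  obtain ⟨p, rfl⟩ := potentialClass_surjective x
  have hanti := potentialClass_mem_edgeCone_iff.1 (hρ.1.le hx)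
  obtain ⟨u, w, huw⟩ : ∃ u w, p u < p w := by
    by_contra! hle
    obtain ⟨v₀⟩ := hconn.nonempty
    exact hx0 (potentialClass_eq_zero_iff.2 ⟨p v₀, fun v => (hle v₀ v).antisymm (hle v v₀)⟩)
  let C := {v | p u < p v}
  have hC : C.Nonempty := ⟨w, huw⟩
  have hC' : Cᶜ.Nonempty := ⟨u, by simp [C]⟩
  have hCρ : cutVector C ∈ ρ := by
    obtain ⟨c, d, hcd⟩ := (isTightlyDetermined_potentialClass_iff hG).1
      (isTightlyDetermined_of_coneDim_eq_one (finite_edgeVectors G) hface hdim hx hx0)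
      (C.indicator 1) fun a b _ hab => indicator_one_eq_indicator_one_iff.2 (by simp [C, hab])
    have hc : 0 ≤ c := by
      have hcu : 0 = c * p u + d := by simpa [C] using hcd u
      have hcw : 1 = c * p w + d := by simpa [C, huw] using hcd w
      nlinarith
    have hcp : cutVector C = c • potentialClass m n p :=
      (potentialClass_eq_iff.2 ⟨d, hcd⟩).trans (map_smul _ c p)
    exact hcp ▸ smul_mem ρ hc hx
  have hC0 := cutVector_ne_zero hC hC'
  refine ⟨C, ⟨hC, hC', fun i j hij hj => lt_of_lt_of_le hj (hanti i j hij), ?_⟩, ?_⟩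
  · exact (isTightlyDetermined_cutVector_iff hG hC hC').1
      (isTightlyDetermined_of_coneDim_eq_one (finite_edgeVectors G) hface hdim hCρ hC0)
  · exact (eq_hull_singleton_of_coneDim_eq_one
      (eq_zero_of_forall_pairing_edgeVectors_eq_zero hG hconn) hface.le hdim hCρ hC0).symm

theorem isRayGenerator_hull_singleton {v : NQ m n} (hv : v ∈ latticeN m n)
    (hprim : ∀ c : ℚ, c • v ∈ latticeN m n → ∃ k : ℤ, c = k) :
    IsRayGenerator (hull ℚ {v}) v := by
  ext x
  constructor
  · rintro ⟨hx, hxN⟩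
    obtain ⟨c, hc, rfl⟩ := mem_hull_singleton.1 hx
    obtain ⟨k, rfl⟩ := hprim c hxN
    lift k to ℕ using Int.cast_nonneg_iff.1 hc
    exact ⟨k, by rw [Int.cast_natCast, Nat.cast_smul_eq_nsmul]⟩
  · rintro ⟨k, rfl⟩
    exact ⟨(hull ℚ {v}).nsmul_mem (subset_hull (Set.mem_singleton v)) k,
      (latticeN m n).nsmul_mem hv k⟩

theorem IsRayGenerator.unique {ρ : PointedCone ℚ (NQ m n)} {v w : NQ m n}
    (hv : IsRayGenerator ρ v) (hw : IsRayGenerator ρ w) : v = w := by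
  have hrange : Set.range (fun k : ℕ => k • v) = Set.range fun k : ℕ => k • w := hv.symm.trans hw
  obtain ⟨k, hk⟩ : v ∈ Set.range fun k : ℕ => k • w := hrange ▸ ⟨1, one_nsmul v⟩
  obtain ⟨l, hl⟩ : w ∈ Set.range fun k : ℕ => k • v := hrange ▸ ⟨1, one_nsmul w⟩
  rcases eq_or_ne v 0 with rfl | hv0
  · simpa using hl
  · have hkl : ((k * l : ℕ) : ℚ) = 1 := smul_left_injective ℚ hv0 (by
      beta_reduce at hk hl ⊢
      rw [Nat.cast_smul_eq_nsmul, mul_smul, hl, hk, one_smul])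
    have hk1 : k = 1 := Nat.eq_one_of_mul_eq_one_right (Nat.cast_eq_one.1 hkl)
    simpa [hk1] using hk.symm

theorem isRayGenerator_cutRay (hC : C.Nonempty) (hC' : Cᶜ.Nonempty) :
    IsRayGenerator (cutRay C) (cutVector C) := by
  refine isRayGenerator_hull_singleton
    (potentialClass_mem_latticeN_iff.2 ⟨C.indicator 1, 0, fun v => ?_⟩) fun c hc => ?_
  · by_cases hv : v ∈ C <;> simp [hv]
  · obtain ⟨u, hu⟩ := hC
    obtain ⟨w, hw⟩ := hC'
    rw [cutVector, ← map_smul] at hc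
    obtain ⟨z, d, hz⟩ := potentialClass_mem_latticeN_iff.1 hc
    have hcu : c = z u + d := by simpa [hu] using hz u
    have hcw : 0 = z w + d := by simpa [Set.notMem_of_mem_compl hw] using hz w
    exact ⟨z u - z w, by push_cast; linarith⟩

theorem IsDirectedBond.isRayGenerator (h : IsDirectedBond G C) :
    IsRayGenerator (cutRay C) (cutVector C) :=
  isRayGenerator_cutRay h.nonempty h.nonempty_compl

theorem bijOn_cutRay (hG : G ≤ completeBipartiteGraph (Fin m) (Fin n)) (hconn : G.Connected) :
    Set.BijOn cutRay {C | IsDirectedBond G C} (extremalRays G) := by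
  refine ⟨fun C hC => hC.cutRay_mem_extremalRays hG hconn, fun C hC D hD h => ?_,
    fun ρ hρ => exists_isDirectedBond_of_mem_extremalRays hG hconn hρ⟩
  exact cutVector_injOn ⟨hC.nonempty, hC.nonempty_compl⟩ ⟨hD.nonempty, hD.nonempty_compl⟩
    (hC.isRayGenerator.unique (h ▸ hD.isRayGenerator))

theorem bijOn_cutVector (hG : G ≤ completeBipartiteGraph (Fin m) (Fin n)) (hconn : G.Connected) :
    Set.BijOn cutVector {C | IsDirectedBond G C} (extremalGenerators G) := by
  refine ⟨fun C hC => ⟨_, hC.cutRay_mem_extremalRays hG hconn, hC.isRayGenerator⟩,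
    fun C hC D hD => cutVector_injOn ⟨hC.nonempty, hC.nonempty_compl⟩
      ⟨hD.nonempty, hD.nonempty_compl⟩, ?_⟩
  rintro v ⟨ρ, hρ, hv⟩
  obtain ⟨C, hC, rfl⟩ := exists_isDirectedBond_of_mem_extremalRays hG hconn hρ
  exact ⟨C, hC, hC.isRayGenerator.unique hv⟩

end DirectedBond

/-! ### First independent sets as directed bonds -/

section Sides

variable {m n : ℕ} {G : SimpleGraph (Vert m n)} {A : Set (Vert m n)} {i j : Fin 2} {u v : Vert m n}

@[simp]
theorem inl_mem_U_iff {a : Fin m} : (.inl a : Vert m n) ∈ (U i : Set (Vert m n)) ↔ i = 0 := by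
  fin_cases i <;> simp [U]

@[simp]
theorem inr_mem_U_iff {b : Fin n} : (.inr b : Vert m n) ∈ (U i : Set (Vert m n)) ↔ i = 1 := by
  fin_cases i <;> simp [U]

theorem mem_U_iff_notMem (hij : i ≠ j) : v ∈ U j ↔ v ∉ U i := by
  cases v <;> simp <;> omega

theorem exists_ne_mem_U (v : Vert m n) : ∃ i j : Fin 2, i ≠ j ∧ v ∈ U j := by
  cases v
  · exact ⟨1, 0, by simp⟩
  · exact ⟨0, 1, by simp⟩

theorem mem_U_of_adj (hG : G ≤ completeBipartiteGraph (Fin m) (Fin n)) (hij : i ≠ j)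
    (hu : u ∈ U i) (huv : G.Adj u v) : v ∈ U j := by
  obtain ⟨a, b, ⟨rfl, rfl⟩ | ⟨rfl, rfl⟩⟩ := exists_eq_inl_inr_of_adj hG huv <;>
    simp only [inl_mem_U_iff, inr_mem_U_iff] at hu ⊢ <;> omega

/-- The part `(U_1 \ A) ∪ (A ∩ U_2)` of the vertex partition attached to a vertex set `A`; the other
part is `(A ∩ U_1) ∪ (U_2 \ A)`. An edge joins the two parts if and only if both or none of its
ends lie in `A`. -/
def cutOf (A : Set (Vert m n)) : Set (Vert m n) :=
  symmDiff A (U 0)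

theorem cutOf_involutive : Function.Involutive (cutOf : Set (Vert m n) → Set (Vert m n)) :=
  fun _ => symmDiff_symmDiff_cancel_right _ _

@[simp]
theorem inl_mem_cutOf_iff {a : Fin m} : .inl a ∈ cutOf A ↔ .inl a ∉ A := by
  simp [cutOf, Set.mem_symmDiff]

@[simp]
theorem inr_mem_cutOf_iff {b : Fin n} : .inr b ∈ cutOf A ↔ .inr b ∈ A := by
  simp [cutOf, Set.mem_symmDiff]

theorem cutOf_eq_union : cutOf A = (A ∩ U 1) ∪ (U 0 \ A) := by
  ext v
  cases v <;> simp

theorem compl_cutOf_eq_union : (cutOf A)ᶜ = (A ∩ U 0) ∪ (U 1 \ A) := by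
  ext v
  cases v <;> simp

theorem cutOf_nonempty_iff : (cutOf A).Nonempty ↔ A ≠ U 0 := by
  rw [Set.nonempty_iff_ne_empty]
  exact symmDiff_eq_bot.not

theorem compl_cutOf_nonempty_iff : (cutOf A)ᶜ.Nonempty ↔ A ≠ U 1 := by
  rw [Set.nonempty_iff_ne_empty, Ne, Ne, Set.ext_iff, Set.ext_iff, Sum.forall, Sum.forall]
  simp

theorem mem_cutOf_iff_of_mem_U (hu : u ∈ U i) (hv : v ∈ U i) :
    (u ∈ cutOf A ↔ v ∈ cutOf A) ↔ (u ∈ A ↔ v ∈ A) := by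
  cases u <;> cases v <;> simp_all [not_iff_not]

theorem mem_cutOf_iff_of_mem_U_of_ne (hij : i ≠ j) (hu : u ∈ U i) (hv : v ∈ U j) :
    (u ∈ cutOf A ↔ v ∈ cutOf A) ↔ (u ∈ A ↔ v ∉ A) := by
  cases u <;> cases v <;>
    grind [inl_mem_U_iff, inr_mem_U_iff, inl_mem_cutOf_iff, inr_mem_cutOf_iff]

theorem mem_cutOf_iff_of_adj (hG : G ≤ completeBipartiteGraph (Fin m) (Fin n)) (huv : G.Adj u v) :
    (u ∈ cutOf A ↔ v ∈ cutOf A) ↔ (u ∈ A ↔ v ∉ A) := by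
  obtain ⟨j, i, hji, hu⟩ := exists_ne_mem_U u
  exact mem_cutOf_iff_of_mem_U_of_ne hji.symm hu (mem_U_of_adj hG hji.symm hu huv)

theorem inducedOn_adj {S : Set (Vert m n)} :
    (inducedOn G S).Adj u v ↔ G.Adj u v ∧ u ∈ S ∧ v ∈ S := by
  refine (SimpleGraph.map_adj _ _ _ _).trans ⟨?_, fun ⟨huv, hu, hv⟩ => ?_⟩
  · rintro ⟨u, v, huv, rfl, rfl⟩
    exact ⟨huv, u.2, v.2⟩
  · exact ⟨⟨u, hu⟩, ⟨v, hv⟩, huv, rfl, rfl⟩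

theorem inducedOn_sup_inducedOn_compl (C : Set (Vert m n)) :
    inducedOn G C ⊔ inducedOn G Cᶜ = deleteCut G C := by
  ext u v
  rw [SimpleGraph.sup_adj, inducedOn_adj, inducedOn_adj, ← and_or_left]
  exact and_congr_right fun _ => iff_iff_and_or_not_and_not.symm

end Sides

section IndependentSets

variable {m n : ℕ} {G : SimpleGraph (Vert m n)} {A B : Set (Vert m n)} {i j : Fin 2}
  {u v : Vert m n}

theorem IsIndep.not_adj (hA : IsIndep G A) (hu : u ∈ A) (hv : v ∈ A) : ¬G.Adj u v :=
  fun h => hA.2 hu hv h.ne h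

theorem IsIndep.insert (hA : IsIndep G A) (hG : G ≤ completeBipartiteGraph (Fin m) (Fin n))
    (hij : i ≠ j) (hv : v ∈ U j) (hvA : v ∉ nbr G (A ∩ U i)) : IsIndep G (insert v A) := by
  refine ⟨Set.insert_nonempty v A, ?_⟩
  have hnot (a : Vert m n) (ha : a ∈ A) : ¬G.Adj v a := fun h =>
    hvA ⟨a, ⟨ha, mem_U_of_adj hG hij.symm hv h⟩, h.symm⟩
  rintro a (rfl | ha) b (rfl | hb) hab
  · exact absurd rfl hab
  · exact hnot b hb
  · exact fun h => hnot a ha h.symm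
  · exact hA.2 ha hb hab

theorem IsIndep.isTwoSided (hA : IsIndep G A) (hG : G ≤ completeBipartiteGraph (Fin m) (Fin n))
    (hconn : G.Connected) (h : ∀ i, (A ∩ U i).Nonempty) : IsTwoSided G A := by
  refine ⟨hA, fun i => ⟨h i, Set.inter_subset_right, fun hi => ?_⟩⟩
  obtain ⟨j, hji⟩ := exists_ne i
  obtain ⟨a, -, hai⟩ := h i
  obtain ⟨w, hwA, hwj⟩ := h j
  have hwa : w ≠ a := fun hwa => (mem_U_iff_notMem hji).1 hai (hwa ▸ hwj)
  obtain ⟨z, hwz⟩ := exists_adj_of_reachable_of_ne (hconn.preconnected w a) hwa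
  exact hA.not_adj hwA (hi (mem_U_of_adj hG hji hwj hwz)).1 hwz

theorem isIndep_of_mem_starIndependentSets (hA : A ∈ starIndependentSets G) : IsIndep G A :=
  hA.elim (fun h => h.1.1) fun h => h.1

theorem ne_U_of_mem_starIndependentSets (hA : A ∈ starIndependentSets G) (i : Fin 2) :
    A ≠ U i := by
  rintro rfl
  rcases hA with ⟨⟨-, h⟩, -⟩ | ⟨⟨⟨a, ha⟩, -⟩, ⟨k, u, hu, hk⟩, -⟩
  · exact (h i).2.ne (Set.inter_self _)
  · rcases eq_or_ne k i with rfl | hki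
    · exact (hk.subset hu).2 rfl
    · exact (mem_U_iff_notMem hki).1 ha (hk.subset ha).1

theorem nbr_inter_U (hG : G ≤ completeBipartiteGraph (Fin m) (Fin n)) (hconn : G.Connected)
    (hA : A ∈ starIndependentSets G) (hij : i ≠ j) (hne : (A ∩ U i).Nonempty) :
    nbr G (A ∩ U i) = U j \ A := by
  have hind := isIndep_of_mem_starIndependentSets hA
  apply Set.Subset.antisymm
  · rintro v ⟨a, ⟨ha, hai⟩, hav⟩
    exact ⟨mem_U_of_adj hG hij hai hav, fun hv => hind.not_adj ha hv hav⟩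
  · rintro v ⟨hv, hvA⟩
    by_contra hvn
    have hins := hind.insert hG hij hv hvn
    have htwo : IsTwoSided G (insert v A) := hins.isTwoSided hG hconn fun k => by
      rcases eq_or_ne k i with rfl | hki
      · exact hne.mono (Set.inter_subset_inter_left _ (Set.subset_insert v A))
      · obtain rfl : k = j := by omega
        exact ⟨v, Set.mem_insert v A, hv⟩
    rcases hA with ⟨-, hmax⟩ | ⟨-, -, hno⟩
    · exact hvA (hmax.2 hins (Set.subset_insert v A) (Set.mem_insert v A))
    · exact hno ⟨_, htwo, Set.subset_insert v A⟩

theorem assocSubgraph_eq_deleteCut (hG : G ≤ completeBipartiteGraph (Fin m) (Fin n))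
    (hconn : G.Connected) (hA : A ∈ starIndependentSets G) :
    assocSubgraph G A = deleteCut G (cutOf A) := by
  have hne := (isIndep_of_mem_starIndependentSets hA).1
  have h0 := nbr_inter_U hG hconn hA (zero_ne_one (α := Fin 2))
  have h1 := nbr_inter_U hG hconn hA (one_ne_zero (α := Fin 2))
  rw [← inducedOn_sup_inducedOn_compl, compl_cutOf_eq_union, cutOf_eq_union, assocSubgraph]
  split_ifs with hA0 hA1
  · rw [Set.inter_eq_left.2 hA0] at h0 ⊢
    rw [h0 hne, sdiff_sdiff_right_self, sup_comm, Set.union_comm (U 0 \ A), Set.inter_comm A]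
    rfl
  · rw [Set.inter_eq_left.2 hA1] at h1 ⊢
    rw [h1 hne, sdiff_sdiff_right_self, Set.union_comm (U 1 \ A), Set.inter_comm A]
    rfl
  · obtain ⟨a, ha, ha0⟩ := Set.not_subset.1 hA0
    obtain ⟨b, hb, hb1⟩ := Set.not_subset.1 hA1
    rw [h0 ⟨b, hb, (mem_U_iff_notMem one_ne_zero).2 hb1⟩,
      h1 ⟨a, ha, (mem_U_iff_notMem zero_ne_one).2 ha0⟩, sup_comm]

theorem mk_indicator_sub_indicator (hij : i ≠ j) :
    (Submodule.Quotient.mk ((U j \ A).indicator 1 - (A ∩ U i).indicator 1) : NQ m n) =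
      cutVector (cutOf A) := by
  rw [mk_eq_potentialClass]
  obtain ⟨rfl, rfl⟩ | ⟨rfl, rfl⟩ : (i = 0 ∧ j = 1) ∨ (i = 1 ∧ j = 0) := by omega
  · refine potentialClass_eq_iff.2 ⟨-1, ?_⟩
    rintro (a | b)
    · by_cases ha : .inl a ∈ A <;> simp [oneNegOne, ha]
    · by_cases hb : .inr b ∈ A <;> simp [oneNegOne, hb]
  · refine congrArg _ (funext ?_)
    rintro (a | b)
    · by_cases ha : .inl a ∈ A <;> simp [oneNegOne, ha]
    · by_cases hb : .inr b ∈ A <;> simp [oneNegOne, hb]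

theorem hyperplane_inter_U_eq_ker (hG : G ≤ completeBipartiteGraph (Fin m) (Fin n))
    (hconn : G.Connected) (hA : A ∈ starIndependentSets G) (hne : (A ∩ U i).Nonempty) :
    hyperplane G (A ∩ U i) = LinearMap.ker ((pairing m n).flip (cutVector (cutOf A))) := by
  obtain ⟨j, hji⟩ := exists_ne i
  ext x
  have hpair : pairing m n x (cutVector (cutOf A)) = sumOver (U j \ A) x - sumOver (A ∩ U i) x := by
    rw [← mk_indicator_sub_indicator hji.symm, pairing_apply_mk]
    exact sub_dotProduct _ _ _
  rw [hyperplane, nbr_inter_U hG hconn hA hji.symm hne, LinearMap.mem_eqLocus, LinearMap.mem_ker,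
    LinearMap.flip_apply, hpair, sub_eq_zero, eq_comm]

end IndependentSets

section Converse

variable {m n : ℕ} {G : SimpleGraph (Vert m n)} {A B : Set (Vert m n)} {i j : Fin 2}
  {u v : Vert m n}

namespace IsDirectedBond

theorem ne_U (h : IsDirectedBond G (cutOf A)) : ∀ i, A ≠ U i :=
  Fin.forall_fin_two.2
    ⟨cutOf_nonempty_iff.1 h.nonempty, compl_cutOf_nonempty_iff.1 h.nonempty_compl⟩

theorem exists_mem_adj (h : IsDirectedBond G (cutOf A))
    (hG : G ≤ completeBipartiteGraph (Fin m) (Fin n)) (huv : u ≠ v)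
    (hside : u ∈ cutOf A ↔ v ∈ cutOf A) (hu : u ∉ A) : ∃ z ∈ A, G.Adj u z := by
  obtain ⟨z, huz, hz⟩ := exists_adj_of_reachable_of_ne (h.reachable u v hside) huv
  exact ⟨z, by_contra fun hzA => hu (((mem_cutOf_iff_of_adj hG huz).1 hz).2 hzA), huz⟩

theorem not_adj_of_mem (h : IsDirectedBond G (cutOf A))
    (hG : G ≤ completeBipartiteGraph (Fin m) (Fin n)) (hu : u ∈ A) (hv : v ∈ A) :
    ¬G.Adj u v := by
  intro huv
  obtain ⟨a, b, ⟨rfl, rfl⟩ | ⟨rfl, rfl⟩⟩ := exists_eq_inl_inr_of_adj hG huv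
  · exact inl_mem_cutOf_iff.1 (h.directed a b huv (inr_mem_cutOf_iff.2 hv)) hu
  · exact inl_mem_cutOf_iff.1 (h.directed a b huv.symm (inr_mem_cutOf_iff.2 hu)) hv

theorem isIndep (h : IsDirectedBond G (cutOf A))
    (hG : G ≤ completeBipartiteGraph (Fin m) (Fin n)) (hne : ¬(m = 1 ∧ n = 1)) :
    IsIndep G A := by
  refine ⟨Set.nonempty_iff_ne_empty.2 ?_, fun u hu v hv _ => h.not_adj_of_mem hG hu hv⟩
  rintro rfl
  have heq {u v : Vert m n} (huv : u ∈ cutOf ∅ ↔ v ∈ cutOf ∅) : u = v := by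
    by_contra hne
    obtain ⟨z, hz, -⟩ := h.exists_mem_adj hG hne huv (Set.notMem_empty u)
    exact hz
  have hm : Subsingleton (Fin m) := ⟨fun a a' => Sum.inl_injective (heq (by simp))⟩
  have hn : Subsingleton (Fin n) := ⟨fun b b' => Sum.inr_injective (heq (by simp))⟩
  obtain ⟨a | b, ha⟩ := h.nonempty
  · obtain ⟨a' | b, hb⟩ := h.nonempty_compl
    · simp at hb
    · exact hne ⟨le_antisymm (Fin.subsingleton_iff_le_one.1 hm) a.pos,
        le_antisymm (Fin.subsingleton_iff_le_one.1 hn) b.pos⟩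
  · simp at ha

theorem inter_U_subset_of_isIndep (h : IsDirectedBond G (cutOf A))
    (hG : G ≤ completeBipartiteGraph (Fin m) (Fin n)) (hij : i ≠ j) (hne : (A ∩ U i).Nonempty)
    (hB : IsIndep G B) (hAB : A ⊆ B) : B ∩ U j ⊆ A := by
  rintro v ⟨hvB, hvj⟩
  by_contra hvA
  obtain ⟨a, ha, hai⟩ := hne
  have hside : v ∈ cutOf A ↔ a ∈ cutOf A :=
    (mem_cutOf_iff_of_mem_U_of_ne hij.symm hvj hai).2 (by simp [hvA, ha])
  obtain ⟨z, hz, hvz⟩ := h.exists_mem_adj hG (ne_of_mem_of_not_mem ha hvA).symm hside hvA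
  exact hB.not_adj hvB (hAB hz) hvz

theorem mem_starIndependentSets (h : IsDirectedBond G (cutOf A))
    (hG : G ≤ completeBipartiteGraph (Fin m) (Fin n)) (hconn : G.Connected)
    (hne : ¬(m = 1 ∧ n = 1)) : A ∈ starIndependentSets G := by
  have hind := h.isIndep hG hne
  by_cases hboth : ∀ i, (A ∩ U i).Nonempty
  · refine Or.inl ⟨hind.isTwoSided hG hconn hboth, hind, fun B hB hAB v hv => ?_⟩
    obtain ⟨i, j, hij, hvj⟩ := exists_ne_mem_U v
    exact h.inter_U_subset_of_isIndep hG hij (hboth i) hB hAB ⟨hv, hvj⟩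
  · obtain ⟨j, hj⟩ := not_forall.1 hboth
    obtain ⟨i, hij⟩ := exists_ne j
    have hnotMem (v : Vert m n) (hv : v ∈ A) : v ∉ U j := fun hvj => hj ⟨v, hv, hvj⟩
    have hAi : A ⊆ U i := fun v hv => (mem_U_iff_notMem hij.symm).2 (hnotMem v hv)
    obtain ⟨u, hu, huA⟩ := Set.exists_of_ssubset (hAi.ssubset_of_ne (h.ne_U i))
    refine Or.inr ⟨hind, ⟨i, u, hu, ?_⟩, ?_⟩
    · refine Set.Subset.antisymm (Set.subset_sdiff_singleton hAi huA) fun v hv => ?_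
      by_contra hvA
      obtain ⟨z, hz, hvz⟩ := h.exists_mem_adj hG hv.2
        ((mem_cutOf_iff_of_mem_U hv.1 hu).2 (iff_of_false hvA huA)) hvA
      exact hnotMem z hz (mem_U_of_adj hG hij hv.1 hvz)
    · rintro ⟨B, hB, hAB⟩
      obtain ⟨w, hw⟩ := (hB.2 j).1
      have hAi' : (A ∩ U i).Nonempty := by rw [Set.inter_eq_left.2 hAi]; exact hind.1
      exact hnotMem w (h.inter_U_subset_of_isIndep hG hij hAi' hB.1 hAB hw) hw.2

end IsDirectedBond

theorem mem_firstIndependentSets_iff (hG : G ≤ completeBipartiteGraph (Fin m) (Fin n))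
    (hconn : G.Connected) (hne : ¬(m = 1 ∧ n = 1)) :
    A ∈ firstIndependentSets G ↔ IsDirectedBond G (cutOf A) := by
  constructor
  · rintro ⟨hA, hcard⟩
    have hC := cutOf_nonempty_iff.2 (ne_U_of_mem_starIndependentSets hA 0)
    have hC' := compl_cutOf_nonempty_iff.2 (ne_U_of_mem_starIndependentSets hA 1)
    rw [assocSubgraph_eq_deleteCut hG hconn hA] at hcard
    refine ⟨hC, hC', fun a b hab hb => ?_,
      (card_connectedComponent_deleteCut_eq_two_iff hC hC').1 hcard⟩
    exact inl_mem_cutOf_iff.2 fun ha => (isIndep_of_mem_starIndependentSets hA).not_adj ha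
      (inr_mem_cutOf_iff.1 hb) hab
  · intro h
    have hA := h.mem_starIndependentSets hG hconn hne
    refine ⟨hA, ?_⟩
    rw [assocSubgraph_eq_deleteCut hG hconn hA]
    exact (card_connectedComponent_deleteCut_eq_two_iff h.nonempty h.nonempty_compl).2 h.reachable

theorem bijOn_cutOf (hG : G ≤ completeBipartiteGraph (Fin m) (Fin n))
    (hconn : G.Connected) (hne : ¬(m = 1 ∧ n = 1)) :
    Set.BijOn cutOf (firstIndependentSets G) {C | IsDirectedBond G C} := by
  have hmem {A : Set (Vert m n)} := mem_firstIndependentSets_iff (A := A) hG hconn hne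
  refine ⟨fun A => hmem.1, cutOf_involutive.injective.injOn, fun C hC => ?_⟩
  exact ⟨cutOf C, hmem.2 (by rwa [cutOf_involutive C]), cutOf_involutive C⟩

end Converse
end EdgeCone

open EdgeCone in
theorem mainTheorem5 (m n : ℕ) (G : SimpleGraph (Fin m ⊕ Fin n))
    (hG : G ≤ completeBipartiteGraph (Fin m) (Fin n)) (hconn : G.Connected)
    (hne : ¬ (m = 1 ∧ n = 1)) :
    ∃ (π : EdgeCone.firstIndependentSets G ≃ EdgeCone.extremalRays G)
      (γ : EdgeCone.firstIndependentSets G ≃ EdgeCone.extremalGenerators G),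
      (∀ (A : EdgeCone.firstIndependentSets G) (i : Fin 2),
        ((A : Set (Fin m ⊕ Fin n)) ∩ EdgeCone.U i).Nonempty →
          EdgeCone.IsFacet
            (EdgeCone.hyperplaneFace G ((A : Set (Fin m ⊕ Fin n)) ∩ EdgeCone.U i))
            (EdgeCone.dualEdgeCone G) ∧
          (π A : PointedCone ℚ (EdgeCone.NQ m n)) =
            EdgeCone.dualFace G
              (EdgeCone.hyperplaneFace G ((A : Set (Fin m ⊕ Fin n)) ∩ EdgeCone.U i))) ∧
      (∀ A : EdgeCone.firstIndependentSets G,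
        EdgeCone.IsRayGenerator
          (π A : PointedCone ℚ (EdgeCone.NQ m n)) (γ A : EdgeCone.NQ m n)) := by
  have hbonds := bijOn_cutOf hG hconn hne
  refine ⟨((bijOn_cutRay hG hconn).comp hbonds).equiv _,
    ((bijOn_cutVector hG hconn).comp hbonds).equiv _, fun A i hA => ?_,
    fun A => (hbonds.mapsTo A.2).isRayGenerator⟩
  have hbond : IsDirectedBond G (cutOf A) := hbonds.mapsTo A.2
  rw [hyperplaneFace, hyperplane_inter_U_eq_ker hG hconn A.2.1 hA]
  exact ⟨hbond.isFacet_ker_flip_inf_dualEdgeCone hG hconn,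
    (hbond.dualFace_ker_flip_inf_dualEdgeCone hG hconn).symm⟩
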